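/- Let $X$ be a complex reflexive Banach space, let $T\colon X\to X$ be a bounded linear operator, and let $T^*\colon X^*\to X^*$, $T^*f=f\circ T$, be its adjoint on the dual space. Suppose that there is a point of the topological boundary $\partial\sigma(T)$ of the spectrum of $T$ that is not an eigenvalue of $T$, or that there is a point of $\partial\sigma(T^*)$ that is not an eigenvalue of $T^*$. Then $T$ has an almost-invariant half-space, that is, there is a norm-closed subspace $Y\subseteq X$ of infinite dimension and infinite codimension, and a finite-dimensional subspace $M\subseteq X$, such that $TY\subseteq Y+M$. -/

import Mathlib

/-- A normed space is reflexive if the canonical embedding into its bidual is onto. -/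
def IsReflexiveSpace (X : Type*) [NormedAddCommGroup X] [NormedSpace ℂ X] : Prop :=
  Function.Surjective (NormedSpace.inclusionInDoubleDual ℂ X)

/-- The Banach-space adjoint `T* : X* → X*`, `T* f = f ∘ T`. -/
noncomputable def dualOperator {X : Type*} [NormedAddCommGroup X] [NormedSpace ℂ X]
    (T : X →L[ℂ] X) : StrongDual ℂ X →L[ℂ] StrongDual ℂ X :=
  ContinuousLinearMap.precomp ℂ T

theorem dualOperator_apply {X : Type*} [NormedAddCommGroup X] [NormedSpace ℂ X]
    (T : X →L[ℂ] X) (f : StrongDual ℂ X) (x : X) : dualOperator T f x = f (T x) :=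
  rfl

/-- Some point of the topological boundary (in `ℂ`) of the spectrum of `T` is not an eigenvalue
of `T`. -/
def HasNonEigenvalueBoundaryPoint {X : Type*} [NormedAddCommGroup X] [NormedSpace ℂ X]
    (T : X →L[ℂ] X) : Prop :=
  ∃ μ ∈ frontier (spectrum ℂ T), ¬ Module.End.HasEigenvalue (T : X →ₗ[ℂ] X) μ

/-- A half-space: a norm-closed subspace of infinite dimension and infinite codimension. -/
structure IsHalfSpace {X : Type*} [NormedAddCommGroup X] [NormedSpace ℂ X]
    (Y : Submodule ℂ X) : Prop where
  isClosed : IsClosed (Y : Set X)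
  infinite_dim : ¬ FiniteDimensional ℂ Y
  infinite_codim : ¬ FiniteDimensional ℂ (X ⧸ Y)

/-- `Y` is almost invariant under `T`: there is a finite-dimensional subspace `M` with
`T Y ⊆ Y + M`. -/
def IsAlmostInvariant {X : Type*} [NormedAddCommGroup X] [NormedSpace ℂ X]
    (T : X →L[ℂ] X) (Y : Submodule ℂ X) : Prop :=
  ∃ M : Submodule ℂ X, FiniteDimensional ℂ M ∧ Y.map (T : X →ₗ[ℂ] X) ≤ Y ⊔ M

/-! Near a boundary point `μ` of the spectrum the resolvents are unbounded, hence by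
Banach–Steinhaus unbounded on one vector `u`. Normalizing the images of `u` gives unit vectors with
`T (x n) = l n • x n - b n • u`, so `T` moves the closed span of any of them only by multiples of
`u`. Reflexivity gives a weak limit `x₀` with `T x₀ = μ • x₀`; as `μ` is not an eigenvalue, `x₀ =
0`. Weakly null unit vectors contain a sequence with biorthogonal functionals
(`exists_biorthogonal`), and every other term spans a half-space. For the adjoint, the same argument
runs in the dual and the preannihilator brings the half-space back. -/

open Filter Topology

/-! ### Mazur's selection of a biorthogonal sequence -/

/-- The elements of `F` keep their norm, up to the factor `c`, when a multiple of `v` is added. -/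
def IsAlmostTransverse {X : Type*} [NormedAddCommGroup X] [NormedSpace ℂ X]
    (F : Submodule ℂ X) (c : ℝ) (v : X) : Prop :=
  ∀ y ∈ F, ∀ a : ℂ, ‖y‖ ≤ c * ‖y + a • v‖

/-- Mazur's lemma: a weakly null sequence of unit vectors is eventually almost transverse to any
finite-dimensional subspace. -/
theorem eventually_isAlmostTransverse {X : Type*} [NormedAddCommGroup X] [NormedSpace ℂ X]
    (U : Ultrafilter ℕ) (x : ℕ → X) (hx : ∀ n, ‖x n‖ = 1)
    (hw : ∀ f : StrongDual ℂ X, Tendsto (fun n => f (x n)) U (𝓝 0))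
    (F : Submodule ℂ X) [FiniteDimensional ℂ F] {c : ℝ} (hc : 1 < c) :
    ∀ᶠ n in U, IsAlmostTransverse F c (x n) := by
  by_contra hcon
  rw [← Ultrafilter.eventually_not] at hcon
  have hc0 : 0 < c := by linarith
  -- Where transversality fails, scaling to `‖y‖ = 1` leaves `‖y + a • x n‖ ≤ 1 / c < 1`, so `‖a‖ ≤
  -- 1 + 1`: both range over compact sets.
  have key : ∀ n, ∃ y : F, ∃ a : ℂ, ‖y‖ = 1 ∧ ‖a‖ ≤ 2 ∧
      (¬ IsAlmostTransverse F c (x n) → c * ‖(y : X) + a • x n‖ ≤ 1) ∨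
      IsAlmostTransverse F c (x n) := by
    intro n
    by_cases h : IsAlmostTransverse F c (x n)
    · exact ⟨0, 0, Or.inr h⟩
    unfold IsAlmostTransverse at h
    push Not at h
    obtain ⟨y, hy, a, hya⟩ := h
    have hy0 : 0 < ‖y‖ := lt_of_le_of_lt (by positivity) hya
    have hle : c * ‖((‖y‖ : ℂ)⁻¹ • y) + ((‖y‖ : ℂ)⁻¹ * a) • x n‖ ≤ 1 := by
      rw [mul_smul, ← smul_add, norm_smul, norm_inv, Complex.norm_real, norm_norm]
      rw [mul_left_comm, inv_mul_le_iff₀ hy0]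
      linarith
    have hn1 : ‖((‖y‖ : ℂ)⁻¹ • y)‖ = 1 := by
      rw [norm_smul, norm_inv, Complex.norm_real, norm_norm, inv_mul_cancel₀ hy0.ne']
    refine ⟨(‖y‖ : ℂ)⁻¹ • ⟨y, hy⟩, (‖y‖ : ℂ)⁻¹ * a, Or.inl ⟨hn1, ?_, fun _ => hle⟩⟩
    have h1 : ‖((‖y‖ : ℂ)⁻¹ • y) + ((‖y‖ : ℂ)⁻¹ * a) • x n‖ ≤ 1 := by
      nlinarith [norm_nonneg (((‖y‖ : ℂ)⁻¹ • y) + ((‖y‖ : ℂ)⁻¹ * a) • x n)]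
    have h2 := norm_sub_le (((‖y‖ : ℂ)⁻¹ • y) + ((‖y‖ : ℂ)⁻¹ * a) • x n) ((‖y‖ : ℂ)⁻¹ • y)
    rw [add_sub_cancel_left, norm_smul, hx n, mul_one] at h2
    linarith
  choose y a hya using key
  have hev : ∀ᶠ n in U, ‖y n‖ = 1 ∧ ‖a n‖ ≤ 2 ∧ c * ‖(y n : X) + a n • x n‖ ≤ 1 := by
    filter_upwards [hcon] with n hn
    rcases hya n with h | h
    · exact ⟨h.1, h.2.1, h.2.2 hn⟩
    · exact absurd h hn
  obtain ⟨y₀, hy₀, hyl⟩ := (isCompact_sphere (0 : F) 1).ultrafilter_le_nhds (U.map y)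
    (by
      rw [le_principal_iff]
      exact hev.mono fun n hn => by simpa using hn.1)
  obtain ⟨a₀, -, hal⟩ := (isCompact_closedBall (0 : ℂ) 2).ultrafilter_le_nhds (U.map a)
    (by
      rw [le_principal_iff]
      exact hev.mono fun n hn => by simpa using hn.2.1)
  have hyt : Tendsto y U (𝓝 y₀) := hyl
  have hat : Tendsto a U (𝓝 a₀) := hal
  -- A norming functional of `y₀` tends to `1` along `y n + a n • x n`, whose norms stay below `1 /
  -- c`.
  obtain ⟨f, hf, hfy⟩ := exists_dual_vector'' ℂ (y₀ : X)
  have hy1 : ‖(y₀ : X)‖ = 1 := by simpa using hy₀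
  have hlim : Tendsto (fun n => f (y n + a n • x n)) U (𝓝 1) := by
    have h1 : Tendsto (fun n => f (y n : X)) U (𝓝 (f y₀)) :=
      ((f.continuous.comp continuous_subtype_val).tendsto y₀).comp hyt
    have h2 := h1.add (hat.mul (hw f))
    simpa [hfy, hy1] using h2
  have hle : ‖(1 : ℂ)‖ ≤ c⁻¹ := by
    refine le_of_tendsto hlim.norm (hev.mono fun n hn => ?_)
    calc ‖f (y n + a n • x n)‖ ≤ 1 * ‖(y n : X) + a n • x n‖ := f.le_of_opNorm_le hf _
      _ ≤ c⁻¹ := by rw [one_mul, ← one_div, le_div_iff₀' hc0]; exact hn.2.2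
  rw [norm_one] at hle
  exact absurd (inv_lt_one_of_one_lt₀ hc) (not_lt.mpr hle)

/-- Selecting successively almost transverse vectors yields a sequence with bounded biorthogonal
functionals. -/
theorem exists_biorthogonal {X : Type*} [NormedAddCommGroup X] [NormedSpace ℂ X] (A : Set X)
    (hA1 : ∀ v ∈ A, ‖v‖ = 1)
    (hA : ∀ F : Submodule ℂ X, FiniteDimensional ℂ F → ∀ c : ℝ, 1 < c →
      ∃ v ∈ A, IsAlmostTransverse F c v) :
    ∃ (e : ℕ → X) (f : ℕ → StrongDual ℂ X), (∀ k, e k ∈ A) ∧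
      ∀ k j, f k (e j) = if k = j then 1 else 0 := by
  classical
  -- The ratios `P (k + 1) / P k` serve as transversality constants; their products telescope and
  -- stay below `2`.
  let P : ℕ → ℝ := fun k => 2 - 1 / (k + 1)
  have hP1 : ∀ k, 1 ≤ P k := fun k => by
    have : (1 : ℝ) / (k + 1) ≤ 1 := by rw [div_le_one (by positivity)]; linarith [k.cast_nonneg (α := ℝ)]
    simp only [P]; linarith
  have hP2 : ∀ k, P k ≤ 2 := fun k => by
    have : (0 : ℝ) ≤ 1 / (k + 1) := by positivity
    simp only [P]; linarith
  have hPlt : ∀ k, P k < P (k + 1) := fun k => by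
    have : (1 : ℝ) / ((k + 1 : ℕ) + 1) < 1 / (k + 1) := by
      apply one_div_lt_one_div_of_lt (by positivity)
      push_cast; linarith
    simp only [P]; linarith
  have hc : ∀ k, 1 < P (k + 1) / P k := fun k => by
    rw [one_lt_div (by linarith [hP1 k])]; exact hPlt k
  choose v hvA hv using fun (s : Finset X) (k : ℕ) =>
    hA (Submodule.span ℂ (s : Set X)) inferInstance _ (hc k)
  let s : ℕ → Finset X := fun k => Nat.rec ∅ (fun k t => insert (v t k) t) k
  let e : ℕ → X := fun k => v (s k) k
  have hs : ∀ k, s (k + 1) = insert (e k) (s k) := fun k => rfl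
  have hes : ∀ k, ∀ i < k, e i ∈ s k := by
    intro k
    induction k with
    | zero => intro i hi; omega
    | succ k ih =>
      intro i hi
      rw [hs, Finset.mem_insert]
      rcases Nat.lt_succ_iff_lt_or_eq.mp hi with h | h
      · exact Or.inr (ih i h)
      · exact Or.inl (by rw [h])
  have hmono : ∀ c : ℕ → ℂ, Monotone fun k => P k * ‖∑ i ∈ Finset.range k, c i • e i‖ := by
    intro c
    refine monotone_nat_of_le_succ fun k => ?_
    have h := hv (s k) k (∑ i ∈ Finset.range k, c i • e i)
      (Submodule.sum_mem _ fun i hi => Submodule.smul_mem _ _ (Submodule.subset_span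
        (hes k i (Finset.mem_range.mp hi)))) (c k)
    have hk : 0 < P k := by linarith [hP1 k]
    rw [div_mul_eq_mul_div, le_div_iff₀ hk] at h
    rw [Finset.sum_range_succ]
    linarith
  -- Each term is a difference of two partial sums, each at most twice the full sum; hence `4`.
  have hcoef : ∀ (c : ℕ → ℂ) (N k : ℕ), k < N →
      ‖c k‖ ≤ 4 * ‖∑ i ∈ Finset.range N, c i • e i‖ := by
    intro c N k hkN
    have hS : ∀ j ≤ N, ‖∑ i ∈ Finset.range j, c i • e i‖
        ≤ 2 * ‖∑ i ∈ Finset.range N, c i • e i‖ := by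
      intro j hj
      have h1 := hmono c hj
      simp only at h1
      nlinarith [norm_nonneg (∑ i ∈ Finset.range j, c i • e i), hP1 j, hP2 N,
        norm_nonneg (∑ i ∈ Finset.range N, c i • e i)]
    have h1 := hS k hkN.le
    have h2 := hS (k + 1) hkN
    have h3 := norm_sub_le (∑ i ∈ Finset.range (k + 1), c i • e i)
      (∑ i ∈ Finset.range k, c i • e i)
    rw [Finset.sum_range_succ, add_sub_cancel_left, norm_smul, hA1 (e k) (hvA _ _), mul_one] at h3
    rw [Finset.sum_range_succ] at h2
    linarith
  have hfin : ∀ (l : ℕ →₀ ℂ) (k : ℕ), ‖l k‖ ≤ 4 * ‖Finsupp.linearCombination ℂ e l‖ := by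
    intro l k
    obtain ⟨N, hN⟩ := l.support.exists_nat_subset_range
    have hsum : Finsupp.linearCombination ℂ e l
        = ∑ i ∈ Finset.range (max N (k + 1)), l i • e i := by
      rw [Finsupp.linearCombination_apply]
      refine Finsupp.sum_of_support_subset _ (hN.trans ?_) _ (by simp)
      exact Finset.range_subset_range.mpr (le_max_left _ _)
    rw [hsum]
    exact hcoef _ _ _ (by omega)
  have hli : LinearIndependent ℂ e := by
    rw [linearIndependent_iff]
    intro l hl
    ext k
    have := hfin l k
    rw [hl, norm_zero, mul_zero] at this
    simpa using this
  have hext : ∀ k, ∃ f : StrongDual ℂ X, ∀ j, f (e j) = if k = j then 1 else 0 := by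
    intro k
    let g : StrongDual ℂ (Submodule.span ℂ (Set.range e)) :=
      LinearMap.mkContinuous (Finsupp.lapply k ∘ₗ hli.repr) 4 (fun x => by
        have := hfin (hli.repr x) k
        rwa [hli.linearCombination_repr] at this)
    obtain ⟨f, hf, -⟩ := exists_extension_norm_eq _ g
    refine ⟨f, fun j => ?_⟩
    have h := hf ⟨e j, Submodule.subset_span ⟨j, rfl⟩⟩
    rw [show f (e j) = _ from h]
    change hli.repr ⟨e j, Submodule.subset_span ⟨j, rfl⟩⟩ k = _
    rw [hli.repr_eq_single j ⟨e j, Submodule.subset_span ⟨j, rfl⟩⟩ rfl]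
    simp [Finsupp.single_apply, eq_comm]
  choose f hf using hext
  exact ⟨e, f, fun k => hvA _ _, hf⟩

theorem linearIndependent_of_biorthogonal {ι V : Type*} [DecidableEq ι] [AddCommGroup V]
    [Module ℂ V] (v : ι → V) (g : ι → V →ₗ[ℂ] ℂ)
    (h : ∀ k j, g k (v j) = if k = j then 1 else 0) : LinearIndependent ℂ v := by
  rw [linearIndependent_iff]
  intro l hl
  ext k
  have := congrArg (g k) hl
  simpa [Finsupp.linearCombination_apply, Finsupp.sum, h] using this

/-- The closed span of every other vector of a sequence with biorthogonal functionals is a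
half-space. -/
theorem isHalfSpace_closure_span_even {X : Type*} [NormedAddCommGroup X] [NormedSpace ℂ X]
    (e : ℕ → X) (f : ℕ → StrongDual ℂ X) (h : ∀ k j, f k (e j) = if k = j then 1 else 0) :
    IsHalfSpace (Submodule.span ℂ (Set.range fun k => e (2 * k))).topologicalClosure := by
  set Y := (Submodule.span ℂ (Set.range fun k => e (2 * k))).topologicalClosure with hY
  have hmem : ∀ k, e (2 * k) ∈ Y := fun k =>
    Submodule.le_topologicalClosure _ (Submodule.subset_span ⟨k, rfl⟩)
  refine ⟨Submodule.isClosed_topologicalClosure _, fun hfd => ?_, fun hfd => ?_⟩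
  · refine Module.Finite.not_linearIndependent_of_infinite (R := ℂ)
      (fun k => (⟨e (2 * k), hmem k⟩ : Y))
      (linearIndependent_of_biorthogonal _ (fun k => (f (2 * k) : X →ₗ[ℂ] ℂ) ∘ₗ Y.subtype) ?_)
    intro k j
    simp [h]
  -- The odd functionals vanish on `Y`, so the odd vectors stay independent modulo `Y`.
  · have hker : ∀ k, Y ≤ LinearMap.ker (f (2 * k + 1) : X →ₗ[ℂ] ℂ) := by
      intro k
      refine Submodule.topologicalClosure_minimal _ ?_ (f (2 * k + 1)).isClosed_ker
      rw [Submodule.span_le]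
      rintro _ ⟨j, rfl⟩
      simp only [SetLike.mem_coe, LinearMap.mem_ker, ContinuousLinearMap.coe_coe, h]
      rw [if_neg (by omega)]
    refine Module.Finite.not_linearIndependent_of_infinite (R := ℂ)
      (fun k => Y.mkQ (e (2 * k + 1)))
      (linearIndependent_of_biorthogonal _ (fun k => Y.liftQ _ (hker k)) ?_)
    intro k j
    simp [h]

/-! ### Weak limits and reflexivity -/

/-- Banach–Alaoglu in the bidual; reflexivity makes the limit an evaluation at a point. -/
theorem tendsto_weak_of_isReflexiveSpace {X : Type*} [NormedAddCommGroup X] [NormedSpace ℂ X]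
    (hX : IsReflexiveSpace X) (U : Ultrafilter ℕ) (x : ℕ → X) (hx : ∀ n, ‖x n‖ ≤ 1) :
    ∃ x₀ : X, ∀ f : StrongDual ℂ X, Tendsto (fun n => f (x n)) U (𝓝 (f x₀)) := by
  let J : ℕ → WeakDual ℂ (StrongDual ℂ X) := fun n =>
    StrongDual.toWeakDual (NormedSpace.inclusionInDoubleDual ℂ X (x n))
  obtain ⟨φ, -, hφ⟩ := (WeakDual.isCompact_closedBall (𝕜 := ℂ) (E := StrongDual ℂ X) 0 1)
    |>.ultrafilter_le_nhds (U.map J) (by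
      rw [le_principal_iff]
      refine Ultrafilter.mem_coe.mp (Ultrafilter.mem_map.mpr (Filter.univ_mem' fun n => ?_))
      exact (dist_zero_right (NormedSpace.inclusionInDoubleDual ℂ X (x n))).le.trans
        ((NormedSpace.double_dual_bound ℂ X (x n)).trans (hx n)))
  obtain ⟨x₀, hx₀⟩ := hX (WeakDual.toStrongDual φ)
  refine ⟨x₀, fun f => ?_⟩
  have h1 : Tendsto J U (𝓝 φ) := hφ
  have h2 := ((WeakDual.eval_continuous f).tendsto φ).comp h1
  have h3 : φ f = f x₀ := by
    rw [← NormedSpace.dual_def ℂ X x₀ f, hx₀]; rfl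
  rw [← h3]
  exact h2

theorem IsReflexiveSpace.dual {X : Type*} [NormedAddCommGroup X] [NormedSpace ℂ X]
    (hX : IsReflexiveSpace X) : IsReflexiveSpace (StrongDual ℂ X) := by
  intro Φ
  refine ⟨Φ.comp (NormedSpace.inclusionInDoubleDual ℂ X), ?_⟩
  ext ξ
  obtain ⟨x, rfl⟩ := hX ξ
  rfl

/-! ### Approximate eigenvectors from resolvents -/

/-- The resolvents at points approaching a spectral value are unbounded in norm. -/
theorem not_bounded_resolvent {R : Type*} [NormedRing R] [NormedAlgebra ℂ R] [CompleteSpace R]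
    (T : R) {μ : ℂ} (hμ : μ ∈ spectrum ℂ T) {l : ℕ → ℂ}
    (hl : ∀ n, l n ∉ spectrum ℂ T) (hlim : Tendsto l atTop (𝓝 μ)) (C : ℝ) :
    ¬ ∀ n, ‖resolvent T (l n)‖ ≤ C := by
  intro hC
  have hlim' : Tendsto (fun n => ‖algebraMap ℂ R μ - algebraMap ℂ R (l n)‖ * C) atTop (𝓝 0) := by
    have h := (((continuous_algebraMap ℂ R).tendsto μ).comp hlim)
    have h2 := ((tendsto_const_nhds (x := algebraMap ℂ R μ)).sub h).norm.mul_const C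
    simpa using h2
  obtain ⟨n, hn⟩ := (hlim'.eventually (gt_mem_nhds one_pos)).exists
  have hu : IsUnit (algebraMap ℂ R (l n) - T) := spectrum.notMem_iff.mp (hl n)
  obtain ⟨u, hu⟩ := hu
  have hr : resolvent T (l n) = ↑u⁻¹ := by
    rw [resolvent, ← hu, Ring.inverse_unit]
  refine spectrum.mem_iff.mp hμ ?_
  have hCn := hC n
  rw [hr] at hCn
  nontriviality R
  have hpos : 0 < ‖(↑u⁻¹ : R)‖ := Units.norm_pos u⁻¹
  refine ⟨u.ofNearby (algebraMap ℂ R μ - T) ?_, rfl⟩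
  rw [hu, sub_sub_sub_cancel_right, ← one_div, lt_div_iff₀ hpos]
  exact (mul_le_mul_of_nonneg_left hCn (norm_nonneg _)).trans_lt hn

/-- Near a spectral value approached by resolvent points there are normalized resolvent images
that are approximate eigenvectors. -/
theorem exists_approx_eigenvectors {X : Type*} [NormedAddCommGroup X] [NormedSpace ℂ X]
    [CompleteSpace X] (T : X →L[ℂ] X) {μ : ℂ} (hμ : μ ∈ frontier (spectrum ℂ T)) :
    ∃ (u : X) (x : ℕ → X) (l b : ℕ → ℂ), (∀ n, ‖x n‖ = 1) ∧ Tendsto l atTop (𝓝 μ) ∧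
      Tendsto b atTop (𝓝 0) ∧ ∀ n, T (x n) = l n • x n - b n • u := by
  have hμσ : μ ∈ spectrum ℂ T := (spectrum.isClosed T).frontier_subset hμ
  rw [frontier_eq_closure_inter_closure] at hμ
  obtain ⟨l, hl, hlim⟩ := mem_closure_iff_seq_limit.mp hμ.2
  have hunb : ∃ u : X, ∀ C : ℝ, ∃ n, C < ‖resolvent T (l n) u‖ := by
    by_contra! hcon
    obtain ⟨C, hC⟩ := banach_steinhaus (g := fun n => resolvent T (l n)) hcon
    exact not_bounded_resolvent T hμσ hl hlim C hC
  obtain ⟨u, hu⟩ := hunb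
  have hu' : ∀ k : ℕ, ∃ n ≥ k, (k : ℝ) < ‖resolvent T (l n) u‖ := by
    intro k
    -- Exceeding the sum of the first `k` norms forces `n ≥ k`, so the selected points still
    -- converge to `μ`.
    obtain ⟨n, hn⟩ := hu (k + ∑ i ∈ Finset.range k, ‖resolvent T (l i) u‖)
    have hsum : 0 ≤ ∑ i ∈ Finset.range k, ‖resolvent T (l i) u‖ :=
      Finset.sum_nonneg fun i _ => norm_nonneg _
    refine ⟨n, ?_, by linarith⟩
    by_contra hnk
    have := Finset.single_le_sum (f := fun i => ‖resolvent T (l i) u‖)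
      (fun i _ => norm_nonneg _) (Finset.mem_range.mpr (not_le.mp hnk))
    linarith [k.cast_nonneg (α := ℝ)]
  choose n hn hnb using hu'
  have hpos : ∀ k, 0 < ‖resolvent T (l (n k)) u‖ := fun k =>
    (Nat.cast_nonneg k).trans_lt (hnb k)
  have hres : ∀ k, T (resolvent T (l (n k)) u) = l (n k) • resolvent T (l (n k)) u - u := by
    intro k
    have h := Ring.mul_inverse_cancel _ (spectrum.notMem_iff.mp (hl (n k)))
    have h2 := DFunLike.congr_fun h u
    change l (n k) • (resolvent T (l (n k)) u) - T (resolvent T (l (n k)) u) = u at h2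
    exact eq_sub_of_add_eq' (sub_eq_iff_eq_add.mp h2).symm
  refine ⟨u, fun k => ((‖resolvent T (l (n k)) u‖ : ℂ)⁻¹) • resolvent T (l (n k)) u,
    fun k => l (n k), fun k => (‖resolvent T (l (n k)) u‖ : ℂ)⁻¹, fun k => ?_, ?_, ?_, fun k => ?_⟩
  · rw [norm_smul, norm_inv, Complex.norm_real, norm_norm, inv_mul_cancel₀ (hpos k).ne']
  · exact hlim.comp (tendsto_atTop_mono hn tendsto_id)
  · rw [tendsto_zero_iff_norm_tendsto_zero]
    have : Tendsto (fun k => ‖resolvent T (l (n k)) u‖) atTop atTop :=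
      tendsto_atTop_mono (fun k => (hnb k).le) tendsto_natCast_atTop_atTop
    have h := this.inv_tendsto_atTop
    simp only [norm_inv, Complex.norm_real, norm_norm]
    exact h
  · rw [map_smul, hres, smul_sub, smul_comm]

/-! ### Passing from the dual back to the space -/

/-- The common kernel of the functionals in `Y`. -/
def preannihilator {X : Type*} [NormedAddCommGroup X] [NormedSpace ℂ X]
    (Y : Submodule ℂ (StrongDual ℂ X)) : Submodule ℂ X :=
  ⨅ f : Y, LinearMap.ker (f.1 : X →ₗ[ℂ] ℂ)

theorem mem_preannihilator {X : Type*} [NormedAddCommGroup X] [NormedSpace ℂ X]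
    {Y : Submodule ℂ (StrongDual ℂ X)} {x : X} :
    x ∈ preannihilator Y ↔ ∀ f ∈ Y, f x = 0 := by
  simp [preannihilator]

/-- In a reflexive space a closed subspace of the dual is determined by its preannihilator. -/
theorem mem_of_forall_preannihilator {X : Type*} [NormedAddCommGroup X] [NormedSpace ℂ X]
    (hX : IsReflexiveSpace X) {Y : Submodule ℂ (StrongDual ℂ X)}
    (hY : IsClosed (Y : Set (StrongDual ℂ X))) {f : StrongDual ℂ X}
    (hf : ∀ x ∈ preannihilator Y, f x = 0) : f ∈ Y := by
  by_contra hfY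
  have := hY
  have hne : (Y.mkQ f) ≠ 0 := by simpa using hfY
  have hnorm : ‖Y.mkQ f‖ ≠ 0 := fun h0 => hne
    (@norm_eq_zero _ (Submodule.Quotient.normedAddCommGroup Y).toNormedAddGroup _ |>.mp h0)
  -- Hahn–Banach on the quotient separates `f` from `Y`; reflexivity turns the separating functional
  -- into a point of `X`.
  obtain ⟨g, hg1, hg⟩ := exists_dual_vector ℂ (Y.mkQ f) hnorm
  obtain ⟨x, hx⟩ := hX (g.comp Y.mkQL)
  have hev : ∀ h : StrongDual ℂ X, h x = g (Y.mkQ h) := fun h => by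
    rw [← NormedSpace.dual_def ℂ X x h, hx]; rfl
  have hxY : x ∈ preannihilator Y := mem_preannihilator.mpr fun h hh => by
    rw [hev, (Submodule.Quotient.mk_eq_zero Y).mpr hh |> (show Y.mkQ h = 0 from ·), map_zero]
  have h0 := hf x hxY
  rw [hev, hg] at h0
  exact hnorm (Complex.ofReal_eq_zero.mp h0)

/-- Dimension and codimension swap: functionals vanishing on the preannihilator lie in `Y`, and `Y`
embeds in the dual of the quotient by it. -/
theorem IsHalfSpace.preannihilator {X : Type*} [NormedAddCommGroup X] [NormedSpace ℂ X]
    (hX : IsReflexiveSpace X) {Y : Submodule ℂ (StrongDual ℂ X)} (hY : IsHalfSpace Y) :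
    IsHalfSpace (preannihilator Y) := by
  refine ⟨?_, fun hfd => hY.infinite_codim ?_, fun hfd => hY.infinite_dim ?_⟩
  · rw [_root_.preannihilator, Submodule.coe_iInf]
    exact isClosed_iInter fun f => f.1.isClosed_ker
  · let ρ : StrongDual ℂ X →ₗ[ℂ] (_root_.preannihilator Y →ₗ[ℂ] ℂ) :=
      { toFun := fun f => (f : X →ₗ[ℂ] ℂ) ∘ₗ (_root_.preannihilator Y).subtype
        map_add' := fun _ _ => rfl
        map_smul' := fun _ _ => rfl }
    have hker : LinearMap.ker ρ ≤ Y := fun f hf =>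
      mem_of_forall_preannihilator hX hY.isClosed fun x hx =>
        LinearMap.congr_fun (LinearMap.mem_ker.mp hf) ⟨x, hx⟩
    have : FiniteDimensional ℂ (StrongDual ℂ X ⧸ LinearMap.ker ρ) :=
      Module.Finite.equiv ρ.quotKerEquivRange.symm
    exact Module.Finite.of_surjective (Submodule.factor hker) (Submodule.factor_surjective hker)
  · let ρ : Y →ₗ[ℂ] ((X ⧸ _root_.preannihilator Y) →ₗ[ℂ] ℂ) :=
      { toFun := fun f => (_root_.preannihilator Y).liftQ (f.1 : X →ₗ[ℂ] ℂ)
          fun x hx => mem_preannihilator.mp hx f.1 f.2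
        map_add' := fun _ _ => by ext; rfl
        map_smul' := fun _ _ => by ext; rfl }
    refine Module.Finite.of_injective ρ fun f g hfg => ?_
    ext x
    exact LinearMap.congr_fun hfg (Submodule.Quotient.mk x)

/-- `T` keeps in the preannihilator those of its vectors that `M` also kills. They have finite
codimension there, and the image of a complement `N` absorbs the rest. -/
theorem IsAlmostInvariant.preannihilator {X : Type*} [NormedAddCommGroup X] [NormedSpace ℂ X]
    {T : X →L[ℂ] X} {Y : Submodule ℂ (StrongDual ℂ X)}
    (hY : IsAlmostInvariant (dualOperator T) Y) : IsAlmostInvariant T (preannihilator Y) := by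
  obtain ⟨M, hM, hYM⟩ := hY
  let ρ : _root_.preannihilator Y →ₗ[ℂ] (M →ₗ[ℂ] ℂ) :=
    { toFun := fun x =>
        { toFun := fun m => m.1 x.1
          map_add' := fun _ _ => rfl
          map_smul' := fun _ _ => rfl }
      map_add' := fun _ _ => by ext; simp
      map_smul' := fun _ _ => by ext; simp }
  obtain ⟨N, hN⟩ := Submodule.exists_isCompl (LinearMap.ker ρ)
  have hNfd : FiniteDimensional ℂ N :=
    Module.Finite.equiv
      (ρ.quotKerEquivRange.symm.trans (Submodule.quotientEquivOfIsCompl _ _ hN))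
  refine ⟨(N.map (_root_.preannihilator Y).subtype).map (T : X →ₗ[ℂ] X), inferInstance, ?_⟩
  rintro _ ⟨x, hx, rfl⟩
  obtain ⟨z, hz, w, hw, hzw⟩ := Submodule.mem_sup.mp
    (hN.sup_eq_top ▸ Submodule.mem_top : (⟨x, hx⟩ : _root_.preannihilator Y) ∈ LinearMap.ker ρ ⊔ N)
  have hxzw : x = z.1 + w.1 := (congrArg Subtype.val hzw).symm
  rw [hxzw, map_add]
  refine Submodule.add_mem_sup (mem_preannihilator.mpr fun f hf => ?_)
    (Submodule.mem_map_of_mem (Submodule.mem_map_of_mem hw))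
  obtain ⟨g, hg, m, hm, hgm⟩ := Submodule.mem_sup.mp (hYM (Submodule.mem_map_of_mem hf))
  have h1 : f (T z.1) = g z.1 + m z.1 := (DFunLike.congr_fun hgm z.1).symm
  have h2 : m z.1 = 0 := LinearMap.congr_fun (LinearMap.mem_ker.mp hz) ⟨m, hm⟩
  change f (T z.1) = 0
  rw [h1, h2, mem_preannihilator.mp z.2 g hg, add_zero]

/-! ### Construction of the half-space -/

theorem exists_halfSpace_of_hasNonEigenvalueBoundaryPoint {X : Type*} [NormedAddCommGroup X]
    [NormedSpace ℂ X] [CompleteSpace X] (hX : IsReflexiveSpace X) (T : X →L[ℂ] X)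
    (hT : HasNonEigenvalueBoundaryPoint T) :
    ∃ Y : Submodule ℂ X, IsHalfSpace Y ∧ IsAlmostInvariant T Y := by
  obtain ⟨μ, hμ, hne⟩ := hT
  obtain ⟨u, x, l, b, hx, hl, hb, hTx⟩ := exists_approx_eigenvectors T hμ
  let U : Ultrafilter ℕ := hyperfilter ℕ
  have hU : (U : Filter ℕ) ≤ atTop := Nat.hyperfilter_le_atTop
  obtain ⟨x₀, hx₀⟩ := tendsto_weak_of_isReflexiveSpace hX U x fun n => (hx n).le
  have hTx₀ : T x₀ = μ • x₀ := by
    refine SeparatingDual.eq_iff_forall_dual_eq (R := ℂ) |>.mpr fun f => ?_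
    have h1 : Tendsto (fun n => f (T (x n))) U (𝓝 (f (T x₀))) := hx₀ (f.comp T)
    have h2 := ((hl.mono_left hU).mul (hx₀ f)).sub ((hb.mono_left hU).mul_const (f u))
    rw [zero_mul, sub_zero] at h2
    rw [map_smul, smul_eq_mul]
    refine tendsto_nhds_unique h1 (h2.congr fun n => ?_)
    simp [hTx n]
  have hx₀0 : x₀ = 0 := by
    by_contra h0
    exact hne (Module.End.hasEigenvalue_of_hasEigenvector
      (Module.End.hasEigenvector_iff.mpr ⟨Module.End.mem_eigenspace_iff.mpr hTx₀, h0⟩))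
  simp only [hx₀0, map_zero] at hx₀
  obtain ⟨e, f, heA, hef⟩ := exists_biorthogonal (Set.range x)
    (by rintro _ ⟨n, rfl⟩; exact hx n)
    (fun F hF c hc => by
      obtain ⟨n, hn⟩ := (eventually_isAlmostTransverse U x hx hx₀ F hc).exists
      exact ⟨x n, ⟨n, rfl⟩, hn⟩)
  have hY := isHalfSpace_closure_span_even e f hef
  refine ⟨_, hY, Submodule.span ℂ {u}, inferInstance, ?_⟩
  -- A closed subspace plus a finite-dimensional one is closed, so checking the spanning vectors
  -- suffices.
  rw [Submodule.map_le_iff_le_comap]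
  refine Submodule.topologicalClosure_minimal _ ?_ ?_
  · rw [Submodule.span_le]
    rintro _ ⟨k, rfl⟩
    obtain ⟨n, hn⟩ := heA (2 * k)
    change T (e (2 * k)) ∈
      (Submodule.span ℂ (Set.range fun k => e (2 * k))).topologicalClosure ⊔ Submodule.span ℂ {u}
    rw [← hn, hTx n, sub_eq_add_neg, ← neg_smul]
    refine Submodule.add_mem_sup (Submodule.smul_mem _ _
      (Submodule.le_topologicalClosure _ (Submodule.subset_span ⟨k, hn.symm⟩)))
      (Submodule.smul_mem _ _ (Submodule.mem_span_singleton_self u))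
  · exact (Submodule.isClosed_sup_finiteDimensional _ _ hY.isClosed).preimage T.continuous

theorem corollary2p3 {X : Type*} [NormedAddCommGroup X] [NormedSpace ℂ X] [CompleteSpace X]
    (hX : IsReflexiveSpace X) (T : X →L[ℂ] X)
    (hT : HasNonEigenvalueBoundaryPoint T ∨ HasNonEigenvalueBoundaryPoint (dualOperator T)) :
    ∃ Y : Submodule ℂ X, IsHalfSpace Y ∧ IsAlmostInvariant T Y := by
  rcases hT with hT | hT
  · exact exists_halfSpace_of_hasNonEigenvalueBoundaryPoint hX T hT
  · obtain ⟨Y, hY, hTY⟩ :=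
      exists_halfSpace_of_hasNonEigenvalueBoundaryPoint hX.dual (dualOperator T) hT
    exact ⟨preannihilator Y, hY.preannihilator hX, hTY.preannihilator⟩
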